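/- Let $q$ be a prime power, let $r\ge 1$, and let $\delta\in\mathbb F_{q^2}$ satisfy $\delta^{q+1}=-1$. Let $\mathcal H_r=V(X_0^{q+1}+X_1^{q+1}+\cdots+X_{r+1}^{q+1})\subset\mathbb P^{r+1}$ be the Hermitian hypersurface, and call the $\mathbb F_{q^2}$-rational points of $\mathcal H_r$ with $X_0\ne 0$, normalized by $X_0=1$, its affine points. Put $U=\delta X_{r-1}-X_r$ (so $U=\delta-X_1$ if $r=1$), and let $C_1$ be the linear code over $\mathbb F_{q^2}$, with coordinates indexed by the affine points, that consists of the evaluations at these points of all polynomials of total degree at most $1$ in the $r+1$ functions $X_1,\ldots,X_{r-1},U,X_{r+1}$, with coefficients in $\mathbb F_{q^2}$. Then $C_1$ has length $$n=q^{2r+1}-(-1)^{r+1}q^r,$$ dimension $k=r+2$ over $\mathbb F_{q^2}$, and minimum distance (the least Hamming distance between distinct codewords) $$d=\begin{cases} q^{2r+1}-q^{2r-1} & \text{if } r \text{ is even},\\ q^{2r+1}-q^{2r-1}-q^r-q^{r-1} & \text{if } r\text{ is odd}.\end{cases}$$ -/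

import Mathlib

open scoped LinearAlgebra.Projectivization

namespace HermitianCode

variable {F : Type*} [Field F]

/-- The form `X_0^(q+1) + ... + X_{r+1}^(q+1)`. -/
noncomputable def form (F : Type*) [Field F] (q r : ℕ) : MvPolynomial (Fin (r + 2)) F :=
  ∑ i, MvPolynomial.X i ^ (q + 1)

/-- The `F`-rational points of the Hermitian hypersurface in `ℙ^(r+1)`. The condition does not
depend on the representative, see `mk_mem_hypersurface`. -/
def hypersurface (F : Type*) [Field F] (q r : ℕ) : Set (ℙ F (Fin (r + 2) → F)) :=
  {P | MvPolynomial.eval P.rep (form F q r) = 0}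

/-- The affine rational points: those off the hyperplane at infinity `X_0 = 0`. -/
def AffinePoints (F : Type*) [Field F] (q r : ℕ) : Type _ :=
  {P : ℙ F (Fin (r + 2) → F) // P ∈ hypersurface F q r ∧ P.rep 0 ≠ 0}

/-- The value at an affine point of the coordinate `X_i`, dehomogenized by `X_0 = 1`. -/
noncomputable def coord {q r : ℕ} (i : Fin (r + 2)) (P : AffinePoints F q r) : F :=
  P.1.rep i / P.1.rep 0

/-- The coordinate functions `X_1, ..., X_{r-1}, U, X_{r+1}` (in this order) on the affine
points, where `U = δ X_{r-1} - X_r`. (For `r = 1`, `X_{r-1} = X_0 = 1`.) -/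
noncomputable def gen {q r : ℕ} (δ : F) (j : Fin (r + 1)) (P : AffinePoints F q r) : F :=
  if (j : ℕ) + 1 = r then δ * coord ⟨r - 1, by omega⟩ P - coord ⟨r, by omega⟩ P
  else coord j.succ P

/-- Evaluation of polynomials in `X_1, ..., X_{r-1}, U, X_{r+1}` at all affine points. -/
noncomputable def evalMap (q r : ℕ) (δ : F) :
    MvPolynomial (Fin (r + 1)) F →ₗ[F] (AffinePoints F q r → F) :=
  LinearMap.pi fun P => (MvPolynomial.aeval fun j => gen δ j P).toLinearMap

/-- The code `C_a`: evaluations of the polynomials of total degree at most `a` in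
`X_1, ..., X_{r-1}, U, X_{r+1}` at the affine rational points. -/
noncomputable def code (q r : ℕ) (δ : F) (a : ℕ) : Submodule F (AffinePoints F q r → F) :=
  (MvPolynomial.restrictTotalDegree (Fin (r + 1)) F a).map (evalMap q r δ)

instance {q r : ℕ} [Finite F] : Finite (AffinePoints F q r) :=
  inferInstanceAs (Finite {P : ℙ F (Fin (r + 2) → F) // P ∈ hypersurface F q r ∧ P.rep 0 ≠ 0})

noncomputable instance {q r : ℕ} [Finite F] : Fintype (AffinePoints F q r) :=
  Fintype.ofFinite _

/-- `d` is the minimum distance of `C`: the least Hamming distance between distinct codewords. -/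
def IsMinDistance {ι : Type*} [Fintype ι] [DecidableEq F] (C : Submodule F (ι → F)) (d : ℕ) :
    Prop :=
  IsLeast {m : ℕ | ∃ x ∈ C, ∃ y ∈ C, x ≠ y ∧ hammingDist x y = m} d

theorem mk_mem_hypersurface {q r : ℕ} (v : Fin (r + 2) → F) (hv : v ≠ 0) :
    Projectivization.mk F v hv ∈ hypersurface F q r ↔ ∑ i, v i ^ (q + 1) = 0 := by
  obtain ⟨a, ha⟩ := Projectivization.exists_smul_eq_mk_rep F v hv
  simp [hypersurface, form, ← ha, Units.smul_def, mul_pow, ← Finset.mul_sum]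

end HermitianCode

namespace HermitianCode

/-! `U` can be traded for `X_r`, so the code of degree one consists of all functions `b + ∑ a_i x_i`
on the solutions of `∑ x_i ^ (q + 1) = -1` in `F ^ (r + 1)`. Weights therefore come from two counts:
all solutions, and solutions on a hyperplane.

Over the subfield `K` of order `q`, `x ^ (q + 1)` is the norm. Additive characters detect the
equations, the sums split over coordinates, and each factor is a Gauss sum of the norm form
(`sum_addChar_norm_add_trace`). In `card_hermitian_hyperplane` the result depends on `a`, `b` only
through a correction `s` with values `-q ^ 2`, `0`, `-q (q - 1)`, `q`; by `hammingNorm_affineEval`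
the weight of a nonconstant function varies with `-(-1) ^ (r + 1) * s`. So the minimum is at `s = -q
^ 2` for even `r` and at `s = q` for odd `r`. Its positivity makes evaluation injective, which gives
the dimension. -/

/-- A field with `q ^ 2` elements is a quadratic extension of a field with `q` elements. -/
theorem exists_subfield_card {F : Type*} [Field F] [Fintype F] (q : ℕ)
    (hF : Fintype.card F = q ^ 2) :
    ∃ (K : Type) (_ : Field K) (_ : Fintype K) (_ : Algebra K F), Fintype.card K = q := by
  obtain ⟨p, hchar, n, hp, hn⟩ := FiniteField.card' F
  have : Fact p.Prime := ⟨hp⟩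
  obtain ⟨k, -, rfl⟩ := (Nat.dvd_prime_pow hp).1
    (show q ∣ p ^ (n : ℕ) by rw [← hn, hF]; exact dvd_pow_self q two_ne_zero)
  have hk : (n : ℕ) = k * 2 := by
    have := hn.symm.trans hF
    rw [← pow_mul] at this
    exact Nat.pow_right_injective hp.two_le this
  have hk0 : k ≠ 0 := by
    rintro rfl
    simp at hk
  let := ZMod.algebra F p
  have hfr : Module.finrank (ZMod p) F = n := by
    have h := FiniteField.pow_finrank_eq_card p F
    rw [hn] at h
    exact Nat.pow_right_injective hp.two_le h
  obtain ⟨f⟩ := FiniteField.nonempty_algHom_of_finrank_dvd (F := ZMod p)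
    (K := GaloisField p k) (L := F) (by
      rw [GaloisField.finrank p hk0, hfr, hk]
      exact dvd_mul_right k 2)
  refine ⟨GaloisField p k, inferInstance, Fintype.ofFinite _, f.toRingHom.toAlgebra, ?_⟩
  rw [Fintype.card_eq_nat_card, GaloisField.card p k hk0]

/-- A finite field carries a primitive additive character with values in a field of
characteristic zero. -/
theorem exists_isPrimitive_addChar (K : Type*) [Field K] [Finite K] :
    ∃ (R : Type) (_ : Field R) (_ : CharZero R) (ψ : AddChar K R), ψ.IsPrimitive := by
  have h : ringChar ℚ ≠ ringChar K := by
    rw [ringChar.eq_zero]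
    exact (CharP.ringChar_ne_zero_of_finite K).symm
  refine ⟨_, inferInstance, ?_, (AddChar.FiniteField.primitiveChar K ℚ h).char,
    (AddChar.FiniteField.primitiveChar K ℚ h).prim⟩
  exact algebraRat.charZero _

/-! ### Norm, trace and character sums in a quadratic extension -/

section Quadratic

variable {K F : Type*} [Field K] [Fintype K] [Field F] [Algebra K F]

theorem add_pow_card {q : ℕ} (hK : Fintype.card K = q) (x y : F) :
    (x + y) ^ q = x ^ q + y ^ q := by
  simpa [FiniteField.frobeniusAlgHom_apply, hK] using
    map_add (FiniteField.frobeniusAlgHom K F) x y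

theorem algebraMap_pow_card {q : ℕ} (hK : Fintype.card K = q) (t : K) :
    (algebraMap K F t) ^ q = algebraMap K F t := by
  rw [← map_pow, ← hK, FiniteField.pow_card]

variable [Fintype F]

theorem finrank_eq_two {q : ℕ} (hK : Fintype.card K = q) (hF : Fintype.card F = q ^ 2) :
    Module.finrank K F = 2 := by
  have h := Module.card_eq_pow_finrank (K := K) (V := F)
  rw [hF, hK] at h
  exact (Nat.pow_right_injective (hK ▸ Fintype.one_lt_card : 1 < q) h).symm

theorem algebraMap_norm {q : ℕ} (hK : Fintype.card K = q) (hF : Fintype.card F = q ^ 2) (x : F) :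
    algebraMap K F (Algebra.norm K x) = x ^ (q + 1) := by
  rw [FiniteField.algebraMap_norm_eq_pow_sum, finrank_eq_two hK hF, ← Fintype.card_eq_nat_card, hK]
  simp [Finset.sum_range_succ, add_comm]

theorem algebraMap_trace {q : ℕ} (hK : Fintype.card K = q) (hF : Fintype.card F = q ^ 2) (x : F) :
    algebraMap K F (Algebra.trace K F x) = x + x ^ q := by
  rw [FiniteField.algebraMap_trace_eq_sum_pow, finrank_eq_two hK hF, ← Fintype.card_eq_nat_card, hK]
  simp [Finset.sum_range_succ]

/-- The cross terms `x * y ^ q` and `x ^ q * y` are conjugate, so they add up to a trace. This is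
what allows completing the square. -/
theorem norm_add {q : ℕ} (hK : Fintype.card K = q) (hF : Fintype.card F = q ^ 2) (x y : F) :
    Algebra.norm K (x + y) =
      Algebra.norm K x + Algebra.norm K y + Algebra.trace K F (y ^ q * x) := by
  apply (algebraMap K F).injective
  have hy : (y ^ q) ^ q = y := by rw [← pow_mul, ← sq, ← hF, FiniteField.pow_card]
  simp only [map_add, algebraMap_norm hK hF, algebraMap_trace hK hF, pow_succ, mul_pow, hy,
    add_pow_card hK]
  ring

theorem norm_algebraMap_sq {q : ℕ} (hK : Fintype.card K = q) (hF : Fintype.card F = q ^ 2) (t : K) :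
    Algebra.norm K (algebraMap K F t) = t ^ 2 := by
  rw [Algebra.norm_algebraMap, finrank_eq_two hK hF]

variable {R : Type*} [Field R] [CharZero R] {ψ : AddChar K R}

theorem sum_addChar_mul [DecidableEq K] (hψ : ψ.IsPrimitive) (c : K) :
    ∑ t, ψ (t * c) = if c = 0 then (Fintype.card K : R) else 0 := by
  rw [AddChar.sum_mulShift c hψ]
  split_ifs <;> simp

theorem sum_units_addChar_mul [DecidableEq K] (hψ : ψ.IsPrimitive) (c : K) :
    ∑ t ∈ Finset.univ.erase 0, ψ (t * c) = if c = 0 then (Fintype.card K : R) - 1 else -1 := by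
  have h := sum_addChar_mul hψ c
  rw [← Finset.add_sum_erase _ _ (Finset.mem_univ 0), zero_mul, AddChar.map_zero_eq_one] at h
  rw [eq_sub_of_add_eq' h]
  split_ifs <;> simp

/-- The trace is surjective, so `ψ` composed with it is a nontrivial, hence primitive, character of
`F`. -/
theorem sum_addChar_trace [DecidableEq F] (hψ : ψ.IsPrimitive) (c : F) :
    ∑ u : F, ψ (Algebra.trace K F (u * c)) = if c = 0 then (Fintype.card F : R) else 0 := by
  let Ψ : AddChar F R := ψ.compAddMonoidHom (Algebra.trace K F).toAddMonoidHom
  have hΨ : Ψ.IsPrimitive := by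
    apply AddChar.IsPrimitive.of_ne_one
    intro h
    apply hψ (one_ne_zero (α := K))
    ext t
    obtain ⟨x, rfl⟩ := Algebra.trace_surjective K F t
    simpa [Ψ] using DFunLike.congr_fun h x
  have := AddChar.sum_mulShift c hΨ
  simp only [Ψ] at this
  refine Eq.trans ?_ (this.trans ?_)
  · rfl
  · split_ifs <;> simp

/-- Surjectivity of the norm lets one rescale `x`, so the sum `S` is the same for all `t ≠ 0`.
Summed over all `t`, only `x = 0` survives and the total is `q`; as `t = 0` contributes `q ^ 2`, `(q
- 1) S = q - q ^ 2`. -/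
theorem sum_addChar_norm {q : ℕ} (hK : Fintype.card K = q) (hF : Fintype.card F = q ^ 2)
    (hψ : ψ.IsPrimitive) {t : K} (ht : t ≠ 0) :
    ∑ x : F, ψ (t * Algebra.norm K x) = -(q : R) := by
  classical
  have key : ∀ s : K, s ≠ 0 →
      ∑ x : F, ψ (s * Algebra.norm K x) = ∑ x : F, ψ (t * Algebra.norm K x) := by
    intro s hs
    obtain ⟨y, hy⟩ := FiniteField.norm_surjective K F (s / t)
    have hy0 : y ≠ 0 := by
      rintro rfl
      rw [Algebra.norm_zero] at hy
      exact div_ne_zero hs ht hy.symm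
    rw [← Equiv.sum_comp (Equiv.mulLeft₀ y hy0) fun x => ψ (t * Algebra.norm K x)]
    refine Finset.sum_congr rfl fun x _ => ?_
    simp only [Equiv.mulLeft₀_apply, map_mul, hy]
    congr 1
    field_simp
  have h1 : ∑ s : K, ∑ x : F, ψ (s * Algebra.norm K x) = q := by
    rw [Finset.sum_comm]
    simp only [sum_addChar_mul hψ, Algebra.norm_eq_zero_iff, hK]
    simp
  rw [← Finset.add_sum_erase _ _ (Finset.mem_univ 0),
    Finset.sum_congr rfl (fun s hs => key s (Finset.ne_of_mem_erase hs))] at h1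
  simp only [zero_mul, AddChar.map_zero_eq_one, Finset.sum_const, nsmul_eq_mul, Finset.card_univ,
    hF, Finset.mem_univ, Finset.card_erase_of_mem, hK, mul_one] at h1
  have hq : 1 < q := hK ▸ Fintype.one_lt_card
  rw [Nat.cast_sub hq.le] at h1
  push_cast at h1
  have h2 : (q : R) - 1 ≠ 0 := sub_ne_zero.2 (by exact_mod_cast hq.ne')
  apply mul_left_cancel₀ h2
  linear_combination h1

/-- The Gauss sum of the norm form twisted by a linear form. -/
theorem sum_addChar_norm_add_trace {q : ℕ} (hK : Fintype.card K = q)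
    (hF : Fintype.card F = q ^ 2) (hψ : ψ.IsPrimitive) {t : K} (ht : t ≠ 0) (b : F) :
    ∑ x : F, ψ (t * Algebra.norm K x + Algebra.trace K F (b * x)) =
      -(q : R) * ψ (-(Algebra.norm K b / t)) := by
  have hb : (b ^ q) ^ q = b := by rw [← pow_mul, ← sq, ← hF, FiniteField.pow_card]
  have hN : Algebra.norm K (b ^ q) = Algebra.norm K b := by
    apply (algebraMap K F).injective
    rw [algebraMap_norm hK hF, algebraMap_norm hK hF, pow_succ, pow_succ, hb, mul_comm]
  -- Completing the square: the shift of `x` by `b ^ q / t` produces the linear term and the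
  -- constant `N(b) / t`.
  rw [← sum_addChar_norm hK hF hψ ht, ← Equiv.sum_comp (Equiv.addRight (b ^ q * algebraMap K F t⁻¹))
    (fun x => ψ (t * Algebra.norm K x)), Finset.sum_mul]
  refine Finset.sum_congr rfl fun x _ => ?_
  rw [← AddChar.map_add_eq_mul]
  congr 1
  have h1 : (b ^ q * algebraMap K F t⁻¹) ^ q * x = t⁻¹ • (b * x) := by
    rw [mul_pow, hb, algebraMap_pow_card hK, Algebra.smul_def]
    ring
  rw [Equiv.coe_addRight, norm_add hK hF, h1, map_smul, map_mul (Algebra.norm K), hN, norm_algebraMap_sq hK hF,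
    smul_eq_mul]
  field_simp
  ring

end Quadratic

theorem addChar_sum_eq_prod {K R ι : Type*} [Field K] [Field R] [Fintype ι]
    (ψ : AddChar K R) (f : ι → K) : ψ (∑ i, f i) = ∏ i, ψ (f i) := by
  classical
  induction (Finset.univ : Finset ι) using Finset.induction_on with
  | empty => simp
  | insert i s hi ih => rw [Finset.sum_insert hi, Finset.prod_insert hi,
      AddChar.map_add_eq_mul, ih]

/-! ### Counting points by character sums -/

section Counting

variable {K F : Type*} [Field K] [Fintype K] [Field F] [Fintype F] [Algebra K F]
  {R : Type*} [Field R] [CharZero R] {ψ : AddChar K R} {ι : Type*} [Fintype ι]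

theorem sum_pi_addChar_norm_add_trace [DecidableEq ι] {q : ℕ} (hK : Fintype.card K = q)
    (hF : Fintype.card F = q ^ 2) (hψ : ψ.IsPrimitive) {t : K} (ht : t ≠ 0) (c : ι → F) :
    ∑ x : ι → F, ψ (t * ∑ i, Algebra.norm K (x i) + Algebra.trace K F (∑ i, c i * x i)) =
      (-(q : R)) ^ Fintype.card ι * ψ (-((∑ i, Algebra.norm K (c i)) / t)) := by
  have h (x : ι → F) :
      ψ (t * ∑ i, Algebra.norm K (x i) + Algebra.trace K F (∑ i, c i * x i)) =
        ∏ i, ψ (t * Algebra.norm K (x i) + Algebra.trace K F (c i * x i)) := by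
    rw [← addChar_sum_eq_prod, Finset.sum_add_distrib, Finset.mul_sum, map_sum]
  simp_rw [h]
  rw [← Fintype.prod_sum
    (fun i (y : F) => ψ (t * Algebra.norm K y + Algebra.trace K F (c i * y)))]
  simp_rw [sum_addChar_norm_add_trace hK hF hψ ht]
  rw [Finset.prod_mul_distrib, Finset.prod_const, Finset.card_univ, ← addChar_sum_eq_prod,
    Finset.sum_neg_distrib, Finset.sum_div]

theorem sum_pi_addChar_trace [DecidableEq ι] [DecidableEq F] (hψ : ψ.IsPrimitive) (c : ι → F) :
    ∑ x : ι → F, ψ (Algebra.trace K F (∑ i, c i * x i)) =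
      if c = 0 then (Fintype.card F : R) ^ Fintype.card ι else 0 := by
  simp_rw [map_sum, addChar_sum_eq_prod]
  rw [← Fintype.prod_sum (fun i (y : F) => ψ (Algebra.trace K F (c i * y)))]
  simp_rw [mul_comm (c _), sum_addChar_trace hψ]
  split_ifs with hc
  · simp [hc]
  · obtain ⟨i, hi⟩ := Function.ne_iff.1 hc
    exact Finset.prod_eq_zero (Finset.mem_univ i) (if_neg hi)

theorem algebraMap_sum_norm {q : ℕ} (hK : Fintype.card K = q) (hF : Fintype.card F = q ^ 2)
    (x : ι → F) : algebraMap K F (∑ i, Algebra.norm K (x i)) = ∑ i, x i ^ (q + 1) := by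
  rw [map_sum]
  simp_rw [algebraMap_norm hK hF]

theorem sum_norm_add_one_eq_zero_iff {q : ℕ} (hK : Fintype.card K = q)
    (hF : Fintype.card F = q ^ 2) (x : ι → F) :
    ∑ i, Algebra.norm K (x i) + 1 = 0 ↔ ∑ i, x i ^ (q + 1) = -1 := by
  rw [← (algebraMap K F).injective.eq_iff, map_add, algebraMap_sum_norm hK hF, map_one, map_zero,
    eq_neg_iff_add_eq_zero]

/-- The number of solutions of `∑ x_i ^ (q + 1) = -1`. -/
theorem card_hermitian [DecidableEq ι] [DecidableEq F] {q : ℕ} (hF : Fintype.card F = q ^ 2) :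
    (q : ℤ) * Fintype.card {x : ι → F // ∑ i, x i ^ (q + 1) = -1} =
      (q : ℤ) ^ (2 * Fintype.card ι) - (-(q : ℤ)) ^ Fintype.card ι := by
  classical
  obtain ⟨K, _, _, _, hK⟩ := exists_subfield_card q hF
  obtain ⟨R, _, _, ψ, hψ⟩ := exists_isPrimitive_addChar K
  suffices h : (q : R) * Fintype.card {x : ι → F // ∑ i, x i ^ (q + 1) = -1} =
      (q : R) ^ (2 * Fintype.card ι) - (-(q : R)) ^ Fintype.card ι by exact_mod_cast h
  have h1 : (q : R) * Fintype.card {x : ι → F // ∑ i, x i ^ (q + 1) = -1} =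
      ∑ t : K, ∑ x : ι → F, ψ (t * (∑ i, Algebra.norm K (x i) + 1)) := by
    rw [Finset.sum_comm]
    simp_rw [sum_addChar_mul hψ, sum_norm_add_one_eq_zero_iff hK hF]
    rw [← Finset.sum_filter, Finset.sum_const, nsmul_eq_mul, Fintype.card_subtype, hK, mul_comm]
  have h2 (t : K) (ht : t ∈ Finset.univ.erase 0) :
      ∑ x : ι → F, ψ (t * (∑ i, Algebra.norm K (x i) + 1)) =
        (-(q : R)) ^ Fintype.card ι * ψ (t * 1) := by
    have h := sum_pi_addChar_norm_add_trace hK hF hψ (Finset.ne_of_mem_erase ht) (0 : ι → F)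
    simp only [Pi.zero_apply, zero_mul, Finset.sum_const_zero, map_zero, add_zero,
      Algebra.norm_zero, zero_div, neg_zero, AddChar.map_zero_eq_one, mul_one] at h
    rw [← h, Finset.sum_mul]
    simp_rw [mul_add, AddChar.map_add_eq_mul]
  rw [h1, ← Finset.add_sum_erase _ _ (Finset.mem_univ 0), Finset.sum_congr rfl h2,
    ← Finset.mul_sum, sum_units_addChar_mul hψ, if_neg one_ne_zero]
  simp [hF, pow_mul, sub_eq_add_neg]

/-- This is what the terms `t ≠ 0` of the hyperplane count leave once `x` is summed out. If `A = 0`,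
the sums over `t` and `u` separate; otherwise the sum over `u` is again a Gauss sum of the norm,
with coefficient `-A / t`. -/
theorem sum_units_sum_addChar [DecidableEq K] [DecidableEq F] {q : ℕ} (hK : Fintype.card K = q)
    (hF : Fintype.card F = q ^ 2) (hψ : ψ.IsPrimitive) (A : K) (b : F) :
    ∑ t ∈ Finset.univ.erase (0 : K), ∑ u : F,
        ψ (t + Algebra.trace K F (u * b) - Algebra.norm K u * A / t) =
      if A = 0 then (if b = 0 then -(q : R) ^ 2 else 0)
      else if A + Algebra.norm K b = 0 then -(q : R) * (q - 1) else q := by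
  by_cases hA : A = 0
  · subst hA
    rw [if_pos rfl]
    simp only [mul_zero, zero_div, sub_zero, AddChar.map_add_eq_mul, ← Finset.mul_sum,
      sum_addChar_trace hψ]
    rw [← Finset.sum_mul]
    have h := sum_units_addChar_mul hψ (1 : K)
    simp only [mul_one, one_ne_zero, if_false] at h
    rw [h, hF]
    split_ifs <;> simp
  · rw [if_neg hA]
    have h (t : K) (ht : t ∈ Finset.univ.erase 0) :
        ∑ u : F, ψ (t + Algebra.trace K F (u * b) - Algebra.norm K u * A / t) =
          -(q : R) * ψ (t * (1 + Algebra.norm K b / A)) := by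
      have ht0 := Finset.ne_of_mem_erase ht
      have h := sum_addChar_norm_add_trace hK hF hψ (neg_ne_zero.2 (div_ne_zero hA ht0)) b
      have e : t * (1 + Algebra.norm K b / A) = t + -(Algebra.norm K b / -(A / t)) := by
        field_simp
      rw [e, AddChar.map_add_eq_mul, mul_left_comm, ← h, Finset.mul_sum]
      refine Finset.sum_congr rfl fun u _ => ?_
      rw [← AddChar.map_add_eq_mul, mul_comm u b]
      congr 1
      field_simp
      ring
    have e : 1 + Algebra.norm K b / A = 0 ↔ A + Algebra.norm K b = 0 := by
      rw [one_add_div hA, div_eq_zero_iff, or_iff_left hA]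
    rw [Finset.sum_congr rfl h, ← Finset.mul_sum, sum_units_addChar_mul hψ, hK]
    simp only [e]
    split_ifs <;> simp

/-- The number of solutions of `∑ x_i ^ (q + 1) = -1` on the hyperplane `b + ∑ a_i x_i = 0`. -/
theorem card_hermitian_hyperplane [DecidableEq ι] [DecidableEq F] {q : ℕ}
    (hF : Fintype.card F = q ^ 2) {a : ι → F} (ha : a ≠ 0) (b : F) :
    (q : ℤ) ^ 3 * Fintype.card
        {x : ι → F // ∑ i, x i ^ (q + 1) = -1 ∧ b + ∑ i, a i * x i = 0} =
      (q : ℤ) ^ (2 * Fintype.card ι) + (-(q : ℤ)) ^ Fintype.card ι *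
        (if ∑ i, a i ^ (q + 1) = 0 then (if b = 0 then -(q : ℤ) ^ 2 else 0)
        else if ∑ i, a i ^ (q + 1) + b ^ (q + 1) = 0 then -(q : ℤ) * (q - 1) else q) := by
  classical
  obtain ⟨K, _, _, _, hK⟩ := exists_subfield_card q hF
  obtain ⟨R, _, _, ψ, hψ⟩ := exists_isPrimitive_addChar K
  apply Int.cast_injective (α := R)
  push_cast
  have hA : ∑ i, a i ^ (q + 1) = 0 ↔ ∑ i, Algebra.norm K (a i) = 0 := by
    rw [← algebraMap_sum_norm hK hF, map_eq_zero]
  have hB : ∑ i, a i ^ (q + 1) + b ^ (q + 1) = 0 ↔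
      ∑ i, Algebra.norm K (a i) + Algebra.norm K b = 0 := by
    rw [← algebraMap_sum_norm hK hF, ← algebraMap_norm hK hF, ← map_add, map_eq_zero]
  simp only [hA, hB]
  rw [← sum_units_sum_addChar hK hF hψ]
  -- `t` in `K` enforces the Hermitian equation and `u` in `F` the linear one, whence the factor `q
  -- * q ^ 2`.
  have h1 : (q : R) ^ 3 * Fintype.card
        {x : ι → F // ∑ i, x i ^ (q + 1) = -1 ∧ b + ∑ i, a i * x i = 0} =
      ∑ t : K, ∑ u : F, ∑ x : ι → F, ψ (t * (∑ i, Algebra.norm K (x i) + 1)) *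
        ψ (Algebra.trace K F (u * (b + ∑ i, a i * x i))) := by
    have h (x : ι → F) : ∑ t : K, ∑ u : F, ψ (t * (∑ i, Algebra.norm K (x i) + 1)) *
        ψ (Algebra.trace K F (u * (b + ∑ i, a i * x i))) =
        if ∑ i, x i ^ (q + 1) = -1 ∧ b + ∑ i, a i * x i = 0 then (q : R) ^ 3 else 0 := by
      rw [← Finset.sum_mul_sum, sum_addChar_mul hψ, sum_addChar_trace hψ,
        sum_norm_add_one_eq_zero_iff hK hF, hK, hF, ite_and]
      split_ifs <;> simp
      ring
    rw [Finset.sum_congr rfl fun t _ => Finset.sum_comm, Finset.sum_comm]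
    simp_rw [h]
    rw [← Finset.sum_filter, Finset.sum_const, nsmul_eq_mul, Fintype.card_subtype, mul_comm]
  rw [h1, ← Finset.add_sum_erase _ _ (Finset.mem_univ 0)]
  congr 1
  -- The terms with `t = 0`: since `a ≠ 0`, only `u = 0` survives, giving the main term.
  · have h (u : F) : ∑ x : ι → F, ψ (0 * (∑ i, Algebra.norm K (x i) + 1)) *
        ψ (Algebra.trace K F (u * (b + ∑ i, a i * x i))) =
        ψ (Algebra.trace K F (u * b)) *
          if u = 0 then (q : R) ^ (2 * Fintype.card ι) else 0 := by
      have h := sum_pi_addChar_trace hψ (u • a)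
      simp only [smul_eq_zero, or_iff_left ha, hF, Nat.cast_pow, ← pow_mul] at h
      rw [← h, Finset.mul_sum]
      refine Finset.sum_congr rfl fun x _ => ?_
      simp [mul_add, Finset.mul_sum, mul_assoc, AddChar.map_add_eq_mul]
    simp only [h]
    simp
  · rw [Finset.mul_sum]
    refine Finset.sum_congr rfl fun t ht => ?_
    rw [Finset.mul_sum]
    refine Finset.sum_congr rfl fun u _ => ?_
    have h := sum_pi_addChar_norm_add_trace hK hF hψ (Finset.ne_of_mem_erase ht) (u • a)
    have e : t + Algebra.trace K F (u * b) - Algebra.norm K u * (∑ i, Algebra.norm K (a i)) / t =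
        t + Algebra.trace K F (u * b) + -((∑ i, Algebra.norm K ((u • a) i)) / t) := by
      simp [Finset.mul_sum, sub_eq_add_neg]
    rw [e, AddChar.map_add_eq_mul, mul_left_comm, ← h, Finset.mul_sum]
    refine Finset.sum_congr rfl fun x _ => ?_
    rw [← AddChar.map_add_eq_mul, ← AddChar.map_add_eq_mul]
    congr 1
    simp only [mul_add, map_add, Pi.smul_apply, smul_eq_mul, Finset.mul_sum, mul_assoc]
    ring

end Counting

/-! ### The code as a space of affine functions, and its weights -/

section AffineFunctions

variable {F : Type*} [Field F] {q r : ℕ}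

theorem coord_zero (P : AffinePoints F q r) : coord 0 P = 1 := div_self P.2.2

theorem sum_coord_succ_pow (P : AffinePoints F q r) :
    ∑ i : Fin (r + 1), coord i.succ P ^ (q + 1) = -1 := by
  have h := P.2.1
  simp only [hypersurface, form, Set.mem_ofPred_eq, map_sum, map_pow, MvPolynomial.eval_X] at h
  rw [eq_neg_iff_add_eq_zero, add_comm]
  have h0 : coord 0 P ^ (q + 1) + ∑ i : Fin (r + 1), coord i.succ P ^ (q + 1) = 0 := by
    rw [← Fin.sum_univ_succ fun i => coord i P ^ (q + 1)]
    simp only [coord, div_pow]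
    rw [← Finset.sum_div, h, zero_div]
  rwa [coord_zero, one_pow] at h0

theorem coord_injective {P Q : AffinePoints F q r} (h : ∀ i, coord i P = coord i Q) : P = Q := by
  apply Subtype.ext
  rw [← P.1.mk_rep, ← Q.1.mk_rep, Projectivization.mk_eq_mk_iff']
  refine ⟨P.1.rep 0 / Q.1.rep 0, funext fun i => ?_⟩
  have hP := P.2.2
  have hQ := Q.2.2
  have := h i
  simp only [coord] at this
  rw [Pi.smul_apply, smul_eq_mul]
  field_simp at this ⊢
  linear_combination -this

theorem exists_affinePoint (x : Fin (r + 1) → F) (hx : ∑ i, x i ^ (q + 1) = -1) :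
    ∃ P : AffinePoints F q r, ∀ i : Fin (r + 1), coord i.succ P = x i := by
  let v : Fin (r + 2) → F := Fin.cons 1 x
  have hv : v ≠ 0 := fun h => one_ne_zero (congrFun h 0)
  obtain ⟨c, hc⟩ := Projectivization.exists_smul_eq_mk_rep F v hv
  have hrep (i : Fin (r + 2)) : (Projectivization.mk F v hv).rep i = c * v i := by
    rw [← hc]
    rfl
  refine ⟨⟨Projectivization.mk F v hv, (mk_mem_hypersurface v hv).2 ?_, ?_⟩, fun i => ?_⟩
  · simp [v, Fin.sum_univ_succ, hx]
  · simp [hrep, v]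
  · simp [coord, hrep, v]

/-- The affine points correspond to the solutions of `∑ x_i ^ (q + 1) = -1`. -/
noncomputable def affinePointsEquiv (F : Type*) [Field F] (q r : ℕ) :
    AffinePoints F q r ≃ {x : Fin (r + 1) → F // ∑ i, x i ^ (q + 1) = -1} :=
  Equiv.ofBijective (fun P => ⟨fun i => coord i.succ P, sum_coord_succ_pow P⟩) <| by
    refine ⟨fun P Q h => coord_injective fun i => ?_, fun x => ?_⟩
    · refine Fin.cases ?_ (fun i => ?_) i
      · rw [coord_zero, coord_zero]
      · exact congrFun (congrArg Subtype.val h) i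
    · obtain ⟨P, hP⟩ := exists_affinePoint x.1 x.2
      exact ⟨P, Subtype.ext (funext hP)⟩

/-- The evaluation at the affine points of the affine function `b + ∑ a_i X_{i+1}`. -/
noncomputable def affineEval (F : Type*) [Field F] (q r : ℕ) :
    (F × (Fin (r + 1) → F)) →ₗ[F] (AffinePoints F q r → F) where
  toFun v P := v.1 + ∑ i, v.2 i * coord i.succ P
  map_add' v w := by
    ext P
    simp only [Prod.fst_add, Prod.snd_add, Pi.add_apply, add_mul, Finset.sum_add_distrib]
    ring
  map_smul' c v := by
    ext P
    simp [mul_add, Finset.mul_sum, mul_assoc]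

theorem affineEval_apply (v : F × (Fin (r + 1) → F)) (P : AffinePoints F q r) :
    affineEval F q r v P = v.1 + ∑ i, v.2 i * coord i.succ P := rfl

theorem const_one_mem_range_affineEval :
    (fun _ => 1 : AffinePoints F q r → F) ∈ LinearMap.range (affineEval F q r) :=
  ⟨(1, 0), by ext P; simp [affineEval_apply]⟩

theorem coord_mem_range_affineEval (i : Fin (r + 2)) :
    (coord i : AffinePoints F q r → F) ∈ LinearMap.range (affineEval F q r) := by
  refine Fin.cases ?_ (fun i => ?_) i
  · convert! const_one_mem_range_affineEval (F := F) (q := q) (r := r) using 1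
    exact funext coord_zero
  · exact ⟨(0, Pi.single i 1), by ext P; simp [affineEval_apply, Pi.single_apply]⟩

theorem gen_mem_range_affineEval (δ : F) (j : Fin (r + 1)) :
    (gen δ j : AffinePoints F q r → F) ∈ LinearMap.range (affineEval F q r) := by
  by_cases hj : (j : ℕ) + 1 = r
  · have : (gen δ j : AffinePoints F q r → F) =
        δ • coord ⟨r - 1, by omega⟩ - coord ⟨r, by omega⟩ := by
      ext P
      simp [gen, hj]
    rw [this]
    exact sub_mem (Submodule.smul_mem _ _ (coord_mem_range_affineEval _))
      (coord_mem_range_affineEval _)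
  · have : (gen δ j : AffinePoints F q r → F) = coord j.succ := by
      ext P
      simp [gen, hj]
    rw [this]
    exact coord_mem_range_affineEval _

theorem evalMap_mem_code {δ : F} {p : MvPolynomial (Fin (r + 1)) F} {a : ℕ}
    (hp : p.totalDegree ≤ a) : evalMap q r δ p ∈ code q r δ a :=
  Submodule.mem_map_of_mem ((MvPolynomial.mem_restrictTotalDegree _ _ _).2 hp)

theorem const_one_mem_code (δ : F) :
    (fun _ => 1 : AffinePoints F q r → F) ∈ code q r δ 1 := by
  have h := evalMap_mem_code (q := q) (r := r) (δ := δ) (p := 1) (a := 1) (by simp)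
  convert! h using 1
  ext P
  simp [evalMap]

theorem gen_mem_code (δ : F) (j : Fin (r + 1)) :
    (gen δ j : AffinePoints F q r → F) ∈ code q r δ 1 := by
  have h := evalMap_mem_code (q := q) (r := r) (δ := δ) (p := MvPolynomial.X j) (a := 1)
    (by simp [MvPolynomial.totalDegree_X])
  convert! h using 1
  ext P
  simp [evalMap]

theorem coord_mem_code_of_ne (δ : F) {i : Fin (r + 2)} (hi : (i : ℕ) ≠ r) :
    (coord i : AffinePoints F q r → F) ∈ code q r δ 1 := by
  rcases Fin.eq_zero_or_eq_succ i with rfl | ⟨j, rfl⟩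
  · rw [show (coord 0 : AffinePoints F q r → F) = fun _ => 1 from funext coord_zero]
    exact const_one_mem_code δ
  · have : (gen δ j : AffinePoints F q r → F) = coord j.succ := by
      ext P
      rw [Fin.val_succ] at hi
      simp [gen, hi]
    exact this ▸ gen_mem_code δ j

/-- Only `X_r` is missing from the generators, and `X_r = δ X_{r-1} - U`. -/
theorem coord_mem_code (hr : 1 ≤ r) (δ : F) (i : Fin (r + 2)) :
    (coord i : AffinePoints F q r → F) ∈ code q r δ 1 := by
  by_cases hi : (i : ℕ) = r
  · have : (coord i : AffinePoints F q r → F) =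
        δ • coord ⟨r - 1, by omega⟩ - gen δ ⟨r - 1, by omega⟩ := by
      ext P
      have e : i = ⟨r, by omega⟩ := Fin.ext hi
      simp [gen, Nat.sub_add_cancel hr, e]
    rw [this]
    exact sub_mem (Submodule.smul_mem _ _ (coord_mem_code_of_ne δ (by simp; omega)))
      (gen_mem_code δ _)
  · exact coord_mem_code_of_ne δ hi

/-- The code of degree one consists of the evaluations of all affine functions. -/
theorem code_one_eq_range (hr : 1 ≤ r) (δ : F) :
    code q r δ 1 = LinearMap.range (affineEval F q r) := by
  apply le_antisymm
  · rintro _ ⟨p, hp, rfl⟩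
    rw [SetLike.mem_coe, MvPolynomial.mem_restrictTotalDegree] at hp
    rw [p.as_sum, map_sum]
    refine sum_mem fun d hd => ?_
    have hd1 : d.degree ≤ 1 := (MvPolynomial.le_totalDegree hd).trans hp
    have hmon : evalMap q r δ (MvPolynomial.monomial d (p.coeff d)) =
        p.coeff d • fun P => ∏ j, gen δ j P ^ d j := by
      ext P
      simp [evalMap, MvPolynomial.aeval_monomial, Finsupp.prod_fintype]
    rw [hmon]
    refine Submodule.smul_mem _ _ ?_
    rcases Nat.le_one_iff_eq_zero_or_eq_one.1 hd1 with h0 | h1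
    · rw [Finsupp.degree_eq_zero_iff] at h0
      subst h0
      simpa using const_one_mem_range_affineEval
    · obtain ⟨j, rfl⟩ := (Finsupp.sum_eq_one_iff d).1 h1
      convert! gen_mem_range_affineEval (q := q) δ j using 1
      ext P
      rw [Finset.prod_eq_single j (fun k _ hk => by simp [hk.symm]) (by simp)]
      simp
  · rintro _ ⟨v, rfl⟩
    have : affineEval F q r v = v.1 • (fun _ => 1 : AffinePoints F q r → F) +
        ∑ i, v.2 i • (coord i.succ : AffinePoints F q r → F) := by
      ext P
      simp [affineEval_apply]
    rw [this]
    exact add_mem (Submodule.smul_mem _ _ (const_one_mem_code δ))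
      (sum_mem fun i _ => Submodule.smul_mem _ _ (coord_mem_code hr δ _))

theorem hammingNorm_add_card_zeros [DecidableEq F] {ι : Type*} [Fintype ι] (w : ι → F) :
    hammingNorm w + Fintype.card {i // w i = 0} = Fintype.card ι := by
  rw [hammingNorm, Fintype.card_subtype, add_comm, ← Finset.card_univ]
  exact Finset.card_filter_add_card_filter_not (s := Finset.univ) (fun i => w i = 0)

section Weight

variable [Fintype F]

theorem card_affinePoints [DecidableEq F] (hF : Fintype.card F = q ^ 2) :
    (Fintype.card (AffinePoints F q r) : ℤ) =
      (q : ℤ) ^ (2 * r + 1) - (-1) ^ (r + 1) * (q : ℤ) ^ r := by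
  have hq : (q : ℤ) ≠ 0 := by
    rintro h
    have := Fintype.card_ne_zero (α := F)
    simp_all
  have h := card_hermitian (ι := Fin (r + 1)) hF
  rw [← Fintype.card_congr (affinePointsEquiv F q r), Fintype.card_fin] at h
  apply mul_left_cancel₀ hq
  rw [h, neg_pow]
  ring

theorem card_zeros_affineEval [DecidableEq F] (v : F × (Fin (r + 1) → F)) :
    Fintype.card {P // affineEval F q r v P = 0} =
      Fintype.card {x : Fin (r + 1) → F //
        ∑ i, x i ^ (q + 1) = -1 ∧ v.1 + ∑ i, v.2 i * x i = 0} :=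
  Fintype.card_congr <| ((affinePointsEquiv F q r).subtypeEquiv
    (q := fun x => v.1 + ∑ i, v.2 i * x.1 i = 0) fun _ => Iff.rfl).trans
    (Equiv.subtypeSubtypeEquivSubtypeInter (fun x : Fin (r + 1) → F => ∑ i, x i ^ (q + 1) = -1)
      (fun x => v.1 + ∑ i, v.2 i * x i = 0))

/-- The weight of a nonconstant affine function on the affine points. -/
theorem hammingNorm_affineEval [DecidableEq F] (hF : Fintype.card F = q ^ 2)
    {v : F × (Fin (r + 1) → F)} (hv : v.2 ≠ 0) :
    (q : ℤ) ^ 3 * hammingNorm (affineEval F q r v) =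
      (q : ℤ) ^ (2 * r + 4) - (q : ℤ) ^ (2 * r + 2) - (-1) ^ (r + 1) * (q : ℤ) ^ (r + 1) *
        ((q : ℤ) ^ 2 +
          if ∑ i, v.2 i ^ (q + 1) = 0 then (if v.1 = 0 then -(q : ℤ) ^ 2 else 0)
          else if ∑ i, v.2 i ^ (q + 1) + v.1 ^ (q + 1) = 0 then -(q : ℤ) * (q - 1) else q) := by
  have h1 : (hammingNorm (affineEval F q r v) : ℤ) + Fintype.card {P // affineEval F q r v P = 0} =
      Fintype.card (AffinePoints F q r) := mod_cast hammingNorm_add_card_zeros _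
  have h2 := card_hermitian_hyperplane hF hv v.1
  rw [card_zeros_affineEval, card_affinePoints hF] at h1
  rw [Fintype.card_fin, neg_pow] at h2
  rw [eq_sub_of_add_eq h1, mul_sub, h2]
  ring

end Weight

end AffineFunctions

/-! ### The minimum weight and the functions attaining it -/

/-- The minimum distance of the code of degree one. -/
def minDist (q r : ℕ) : ℤ :=
  if Even r then (q : ℤ) ^ (2 * r + 1) - (q : ℤ) ^ (2 * r - 1)
  else (q : ℤ) ^ (2 * r + 1) - (q : ℤ) ^ (2 * r - 1) - (q : ℤ) ^ r - (q : ℤ) ^ (r - 1)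

/-- The factor `q ^ 3` gives the shape of `hammingNorm_affineEval`, free of truncated exponents. -/
theorem cube_mul_minDist (q : ℕ) {r : ℕ} (hr : 1 ≤ r) :
    (q : ℤ) ^ 3 * minDist q r = (q : ℤ) ^ (2 * r + 4) - (q : ℤ) ^ (2 * r + 2) -
      if Even r then 0 else (q : ℤ) ^ (r + 1) * (q ^ 2 + q) := by
  obtain ⟨k, rfl⟩ := Nat.exists_eq_add_of_le' hr
  rw [minDist, show 2 * (k + 1) - 1 = 2 * k + 1 by omega, Nat.add_sub_cancel]
  split_ifs <;> ring

theorem minDist_pos {q r : ℕ} (hq : 2 ≤ q) (hr : 1 ≤ r) : 0 < minDist q r := by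
  obtain ⟨k, rfl⟩ := Nat.exists_eq_add_of_le' hr
  have hq' : (2 : ℤ) ≤ q := mod_cast hq
  have h0 : 0 < (q : ℤ) ^ k := by positivity
  have h1 : 1 ≤ (q : ℤ) ^ k := h0
  rw [minDist, show 2 * (k + 1) - 1 = 2 * k + 1 by omega, Nat.add_sub_cancel]
  split_ifs
  · rw [sub_pos]
    exact pow_lt_pow_right₀ (by linarith) (by omega)
  -- This factorization reduces positivity to `q * (q - 1) ≥ 2`.
  · have e : (q : ℤ) ^ (2 * (k + 1) + 1) - (q : ℤ) ^ (2 * k + 1) - (q : ℤ) ^ (k + 1) -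
        (q : ℤ) ^ k = (q : ℤ) ^ k * (q + 1) * ((q : ℤ) ^ k * (q * (q - 1)) - 1) := by ring
    rw [e]
    have h2 : (2 : ℤ) ≤ q * (q - 1) := by nlinarith
    have h3 : (2 : ℤ) ≤ (q : ℤ) ^ k * (q * (q - 1)) := by nlinarith
    have : 0 < (q : ℤ) ^ k * (q * (q - 1)) - 1 := by linarith
    positivity

variable {F : Type*} [Field F] [Fintype F] {q r : ℕ}

theorem two_le_of_card_eq_sq (hF : Fintype.card F = q ^ 2) : 2 ≤ q := by
  have h : 1 < q ^ 2 := hF ▸ Fintype.one_lt_card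
  by_contra! hq
  interval_cases q <;> simp at h

variable [DecidableEq F]

/-- A nonzero constant vanishes nowhere and has full weight. Otherwise `-q ^ 2 ≤ s ≤ q`, and the
parity of `r` decides which of the two bounds is needed. -/
theorem minDist_le_hammingNorm (hF : Fintype.card F = q ^ 2) (hr : 1 ≤ r)
    {v : F × (Fin (r + 1) → F)} (hv : v ≠ 0) :
    minDist q r ≤ hammingNorm (affineEval F q r v) := by
  have hq : (2 : ℤ) ≤ q := mod_cast two_le_of_card_eq_sq hF
  have hq3 : (0 : ℤ) < (q : ℤ) ^ 3 := by positivity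
  have hqr : (0 : ℤ) < (q : ℤ) ^ (r + 1) := by positivity
  have hq2 : (2 : ℤ) * q ≤ (q : ℤ) ^ 2 := by nlinarith
  apply le_of_mul_le_mul_left _ hq3
  rw [cube_mul_minDist q hr]
  by_cases ha : v.2 = 0
  · have hb : v.1 ≠ 0 := fun hb => hv (Prod.ext hb ha)
    have hw : hammingNorm (affineEval F q r v) = Fintype.card (AffinePoints F q r) := by
      have h := hammingNorm_add_card_zeros (affineEval F q r v)
      have : IsEmpty {P // affineEval F q r v P = 0} :=
        ⟨fun P => hb (by simpa [affineEval_apply, ha] using P.2)⟩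
      simpa using h
    rw [hw, card_affinePoints hF]
    have e : (q : ℤ) ^ 3 * ((q : ℤ) ^ (2 * r + 1) - (-1) ^ (r + 1) * (q : ℤ) ^ r) =
        (q : ℤ) ^ (2 * r + 4) - (-1) ^ (r + 1) * ((q : ℤ) ^ (r + 1) * q ^ 2) := by ring
    have hp : 0 < (q : ℤ) ^ (2 * r + 2) := by positivity
    have hp' : 0 < (q : ℤ) ^ (r + 1) * q ^ 2 := by positivity
    have hp'' : 0 < (q : ℤ) ^ (r + 1) * q := by positivity
    rw [e]
    split_ifs with h
    · rw [h.add_one.neg_one_pow]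
      linarith
    · rw [(Nat.not_even_iff_odd.1 h).add_one.neg_one_pow]
      linarith
  · rw [hammingNorm_affineEval hF ha]
    generalize hs : (if ∑ i, v.2 i ^ (q + 1) = 0 then (if v.1 = 0 then -(q : ℤ) ^ 2 else 0)
      else if ∑ i, v.2 i ^ (q + 1) + v.1 ^ (q + 1) = 0 then -(q : ℤ) * (q - 1) else q) = s
    have hs1 : -(q : ℤ) ^ 2 ≤ s := by
      rw [← hs]
      split_ifs <;> nlinarith
    have hs2 : s ≤ q := by
      rw [← hs]
      split_ifs <;> nlinarith
    split_ifs with h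
    · rw [h.add_one.neg_one_pow]
      have : 0 ≤ (q : ℤ) ^ (r + 1) * (q ^ 2 + s) := mul_nonneg hqr.le (by linarith)
      linarith
    · rw [(Nat.not_even_iff_odd.1 h).add_one.neg_one_pow]
      have : (q : ℤ) ^ (r + 1) * (q ^ 2 + s) ≤ (q : ℤ) ^ (r + 1) * (q ^ 2 + q) :=
        mul_le_mul_of_nonneg_left (by linarith) hqr.le
      linarith

theorem exists_hammingNorm_eq_minDist (hF : Fintype.card F = q ^ 2) (hr : 1 ≤ r) {δ : F}
    (hδ : δ ^ (q + 1) = -1) :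
    ∃ v : F × (Fin (r + 1) → F), v ≠ 0 ∧
      (hammingNorm (affineEval F q r v) : ℤ) = minDist q r := by
  have hq : (2 : ℤ) ≤ q := mod_cast two_le_of_card_eq_sq hF
  have hq3 : (q : ℤ) ^ 3 ≠ 0 := by positivity
  obtain ⟨k, rfl⟩ := Nat.exists_eq_add_of_le' hr
  by_cases h : Even (k + 1)
  -- `1 + δ ^ (q + 1) = 0` makes this vector isotropic; with `b = 0` it gives `s = -q ^ 2`.
  · let a : Fin (k + 2) → F := Fin.cons 1 (Fin.cons δ 0)
    have ha : a ≠ 0 := fun h => one_ne_zero (congrFun h 0)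
    refine ⟨(0, a), fun h => ha (congrArg Prod.snd h), ?_⟩
    have hs : ∑ i, a i ^ (q + 1) = 0 := by simp [a, Fin.sum_univ_succ, hδ]
    apply mul_left_cancel₀ hq3
    rw [hammingNorm_affineEval hF ha, cube_mul_minDist q hr, if_pos h, if_pos hs, if_pos rfl]
    ring
  -- Here the Hermitian form takes the value `1`; with `b = 0` this gives `s = q`.
  · let a : Fin (k + 2) → F := Fin.cons 1 0
    have ha : a ≠ 0 := fun h => one_ne_zero (congrFun h 0)
    refine ⟨(0, a), fun h => ha (congrArg Prod.snd h), ?_⟩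
    have hs : ∑ i, a i ^ (q + 1) = 1 := by simp [a, Fin.sum_univ_succ]
    apply mul_left_cancel₀ hq3
    rw [hammingNorm_affineEval hF ha, cube_mul_minDist q hr, if_neg h, hs, if_neg one_ne_zero,
      if_neg (by simp), (Nat.not_even_iff_odd.1 h).add_one.neg_one_pow, one_mul]

/-- A nonzero kernel element would have weight zero, below the positive `minDist`. -/
theorem affineEval_injective (hF : Fintype.card F = q ^ 2) (hr : 1 ≤ r) :
    Function.Injective (affineEval F q r) := by
  rw [injective_iff_map_eq_zero]
  intro v hv
  by_contra hne
  have h := minDist_le_hammingNorm hF hr hne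
  rw [hv, hammingNorm_zero] at h
  exact absurd (minDist_pos (two_le_of_card_eq_sq hF) hr) (not_lt.2 (by exact_mod_cast h))

end HermitianCode

theorem mainTheorem4 {F : Type*} [Field F] [Fintype F] [DecidableEq F] (q r : ℕ)
    (hF : Fintype.card F = q ^ 2) (hr : 1 ≤ r) (δ : F) (hδ : δ ^ (q + 1) = -1) :
    (Fintype.card (HermitianCode.AffinePoints F q r) : ℤ)
        = (q : ℤ) ^ (2 * r + 1) - (-1) ^ (r + 1) * (q : ℤ) ^ r ∧
    Module.finrank F (HermitianCode.code q r δ 1) = r + 2 ∧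
    ∃ d : ℕ, HermitianCode.IsMinDistance (HermitianCode.code q r δ 1) d ∧
      (d : ℤ) = if Even r then (q : ℤ) ^ (2 * r + 1) - (q : ℤ) ^ (2 * r - 1)
        else (q : ℤ) ^ (2 * r + 1) - (q : ℤ) ^ (2 * r - 1) - (q : ℤ) ^ r - (q : ℤ) ^ (r - 1) := by
  have hinj := HermitianCode.affineEval_injective (r := r) hF hr
  refine ⟨HermitianCode.card_affinePoints hF, ?_, ?_⟩
  · rw [HermitianCode.code_one_eq_range hr, LinearMap.finrank_range_of_inj hinj]
    simp only [Module.finrank_prod, Module.finrank_self, Module.finrank_fintype_fun_eq_card,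
      Fintype.card_fin]
    ring
  · obtain ⟨v, hv, hd⟩ := HermitianCode.exists_hammingNorm_eq_minDist hF hr hδ
    refine ⟨_, ⟨⟨HermitianCode.affineEval F q r v, ?_, 0, zero_mem _, ?_, hammingDist_zero_right _⟩,
      ?_⟩, hd⟩
    · rw [HermitianCode.code_one_eq_range hr]
      exact ⟨v, rfl⟩
    · exact fun h => hv (hinj (h.trans (map_zero _).symm))
    · rintro _ ⟨x, hx, y, hy, hxy, rfl⟩
      -- The difference is written `-x + y` to match `hammingDist_eq_hammingNorm`.
      have hsub := add_mem (neg_mem hx) hy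
      rw [HermitianCode.code_one_eq_range hr] at hsub
      obtain ⟨w, hw⟩ := hsub
      have hw0 : w ≠ 0 := by
        rintro rfl
        exact hxy (neg_add_eq_zero.1 (hw.symm.trans (map_zero _)))
      have h := HermitianCode.minDist_le_hammingNorm hF hr hw0
      rw [← hd, hw, ← hammingDist_eq_hammingNorm] at h
      exact_mod_cast h
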